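/- Let $A_1,\dots,A_s\in\mathbb R^{n\times n}$ and $B_1,\dots,B_s\in\mathbb R^{n\times p}$ be the state and input matrices of a Markov jump system with $s$ modes whose mode sequence is a Markov chain with irreducible (in particular, any ergodic) transition matrix $T\in\mathbb R^{s\times s}$. An $r$-cluster partition of $[s]=\{1,\dots,s\}$ is a family of $r$ pairwise disjoint nonempty sets with union $[s]$. Let $\Omega_{1:r}=\{\Omega_1,\dots,\Omega_r\}$ be an $r$-cluster partition of $[s]$ and $\epsilon_A,\epsilon_B,\epsilon_T\ge 0$ be such that $$\sum_{k\in[r]}\sum_{i,i'\in\Omega_k}\|A_i-A_{i'}\|_F\le\epsilon_A,\qquad \sum_{k\in[r]}\sum_{i,i'\in\Omega_k}\|B_i-B_{i'}\|_F\le\epsilon_B,\qquad \sum_{k\in[r]}\sum_{i,i'\in\Omega_k}\|T(i,:)-T(i',:)\|_1\le\epsilon_T .$$ Let $\alpha_A,\alpha_B,\alpha_T\ge 0$ with $\alpha_A+\alpha_B+\alpha_T=1$, and let $\Phi$ be the feature matrix with rows $$\Phi(i,:)=[\alpha_A\,\mathrm{vec}(A_i)^{\top},\ \alpha_B\,\mathrm{vec}(B_i)^{\top},\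 \alpha_T\,T(i,:)],\qquad i\in[s].$$ Let the columns of $U_r\in\mathbb R^{s\times r}$ be (orthonormal) top $r$ left singular vectors of $\Phi$. Let $\epsilon\ge 0$, and let the $r$-cluster partition $\hat\Omega_{1:r}$ of $[s]$ with centers $\hat c_1,\dots,\hat c_r\in\mathbb R^r$ be a $(1+\epsilon)$-approximate k-means solution on the rows of $U_r$: $$\sum_{k\in[r]}\sum_{i\in\hat\Omega_k}\|U_r(i,:)-\hat c_k\|^2\le(1+\epsilon)\min_{\Omega'_{1:r},\,c'_{1:r}}\ \sum_{k\in[r]}\sum_{i\in\Omega'_k}\|U_r(i,:)-c'_k\|^2,$$ the minimum being over all $r$-cluster partitions $\Omega'_{1:r}$ of $[s]$ and all centers $c'_1,\dots,c'_r\in\mathbb R^r$. The misclustering rate is $$\mathrm{MR}(\hat\Omega_{1:r})=\min_{h}\sum_{k\in[r]}\frac{|\{i: i\in\Omega_k,\ i\notin\hat\Omega_{h(k)}\}|}{|\Omega_k|},$$ the minimum being over all bijections $h:[r]\to[r]$. Let $\bar\Phi$ be the averaged feature matrix, $\bar\Phi(i,:)=|\Omega_k|^{-1}\sum_{i'\in\Omega_k}\Phi(i',:)$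 for $i\in\Omega_k$, let $\sigma_r(\bar\Phi)$ be its $r$-th largest singular value, let $|\Omega_{(1)}|$ and $|\Omega_{(r)}|$ be the largest and the smallest of the cluster sizes $|\Omega_1|,\dots,|\Omega_r|$, and let $$\epsilon_{Agg}=\sqrt{\alpha_A^2\epsilon_A^2+\alpha_B^2\epsilon_B^2+\alpha_T^2\epsilon_T^2}.$$ Assume $\mathrm{rank}(\bar\Phi)=r$. If $$\epsilon_{Agg}\le\frac{\sigma_r(\bar\Phi)\sqrt{|\Omega_{(r)}|+|\Omega_{(1)}|}}{8\sqrt{(2+\epsilon)|\Omega_{(1)}|}},$$ then $$\mathrm{MR}(\hat\Omega_{1:r})\le 64(2+\epsilon)\,\sigma_r(\bar\Phi)^{-2}\,\epsilon_{Agg}^2 .$$ Additionally, if $$\epsilon_{Agg}\le\frac{\sigma_r(\bar\Phi)}{8\sqrt{(2+\epsilon)|\Omega_{(1)}|}},$$ then $\mathrm{MR}(\hat\Omega_{1:r})=0$. -/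

import Mathlib

namespace MJSReduction

open scoped Matrix

/-- A Markov jump system `x_{t+1} = A_{ω_t} x_t + B_{ω_t} u_t` with state dimension `n`, input
dimension `p` and `s` modes, where `ω_t` is a Markov chain with transition matrix `T`.
Of ergodicity only irreducibility is required (aperiodicity is not). -/
structure MJS (n p s : ℕ) where
  A : Fin s → Matrix (Fin n) (Fin n) ℝ
  B : Fin s → Matrix (Fin n) (Fin p) ℝ
  T : Matrix (Fin s) (Fin s) ℝ
  stochastic : T ∈ Matrix.rowStochastic ℝ (Fin s)
  irreducible : T.IsIrreducible

/-- `Ω` is an `r`-cluster partition of the `s` modes. -/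
structure IsPartition {r s : ℕ} (Ω : Fin r → Finset (Fin s)) : Prop where
  cover : ∀ i, ∃ k, i ∈ Ω k
  disjoint : ∀ k l, k ≠ l → Disjoint (Ω k) (Ω l)
  nonempty : ∀ k, (Ω k).Nonempty

/-- The size of the largest cluster. -/
noncomputable def maxClusterCard {r s : ℕ} (Ω : Fin r → Finset (Fin s)) : ℕ :=
  ⨆ k, (Ω k).card

/-- The size of the smallest cluster. -/
noncomputable def minClusterCard {r s : ℕ} (Ω : Fin r → Finset (Fin s)) : ℕ :=
  ⨅ k, (Ω k).card

section Perturbation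

open scoped Matrix.Norms.Frobenius

/-- The aggregatable case: `Ω` is a partition of the modes, and `εA, εB, εT` bound the total
within-cluster differences (Frobenius norm for `A_i` and `B_i`, `ℓ¹` norm for the rows of `T`,
sums over ordered pairs). -/
structure IsAggregatableCase {n p s r : ℕ} (S : MJS n p s) (Ω : Fin r → Finset (Fin s))
    (εA εB εT : ℝ) : Prop where
  isPartition : IsPartition Ω
  nonneg_A : 0 ≤ εA
  nonneg_B : 0 ≤ εB
  nonneg_T : 0 ≤ εT
  bound_A : ∑ k, ∑ i ∈ Ω k, ∑ i' ∈ Ω k, ‖S.A i - S.A i'‖ ≤ εA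
  bound_B : ∑ k, ∑ i ∈ Ω k, ∑ i' ∈ Ω k, ‖S.B i - S.B i'‖ ≤ εB
  bound_T : ∑ k, ∑ i ∈ Ω k, ∑ i' ∈ Ω k, ∑ j, |S.T i j - S.T i' j| ≤ εT

end Perturbation

/-- The columns of the feature matrix: entries of `vec A_i`, of `vec B_i`, and of `T(i,:)`. -/
abbrev FeatureIndex (n p s : ℕ) : Type := (Fin n × Fin n) ⊕ (Fin p × Fin n) ⊕ Fin s

/-- The feature matrix with rows `[αA vec(A_i)ᵀ, αB vec(B_i)ᵀ, αT T(i,:)]`. -/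
def featureMatrix {n p s : ℕ} (S : MJS n p s) (αA αB αT : ℝ) :
    Matrix (Fin s) (FeatureIndex n p s) ℝ :=
  Matrix.of fun i => Sum.elim (αA • (S.A i).vec) (Sum.elim (αB • (S.B i).vec) (αT • S.T i))

/-- Every row is replaced by the average of the rows of its cluster
(for a partition exactly one summand is active for each row). -/
noncomputable def averagedMatrix {s r : ℕ} {κ : Type*} (Ω : Fin r → Finset (Fin s))
    (Φ : Matrix (Fin s) κ ℝ) : Matrix (Fin s) κ ℝ :=
  Matrix.of fun i j =>
    ∑ k, if i ∈ Ω k then ((Ω k).card : ℝ)⁻¹ * ∑ i' ∈ Ω k, Φ i' j else 0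

/-- The `i`-th largest singular value of `M`, for `i ≥ 1` (Mathlib counts from `0`). -/
noncomputable def singularValue {s : ℕ} {κ : Type*} [Fintype κ] [DecidableEq κ]
    (M : Matrix (Fin s) κ ℝ) (i : ℕ) : ℝ :=
  (Matrix.toEuclideanLin M).singularValues (i - 1)

/-- The columns of `U` are top `r` left singular vectors of `Φ`: they are the first `r` columns
of an orthogonal `W` that is the left factor of a singular value decomposition of `Φ` with
singular values in decreasing order (padded by zeros), i.e. `Φ Φᵀ = W diag(σ²) Wᵀ`. -/
def IsTopLeftSingularVectors {s r : ℕ} {κ : Type*} [Fintype κ]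
    (Φ : Matrix (Fin s) κ ℝ) (U : Matrix (Fin s) (Fin r) ℝ) : Prop :=
  ∃ (W : Matrix (Fin s) (Fin s) ℝ) (σ : Fin s → ℝ) (hrs : r ≤ s),
    W ∈ Matrix.orthogonalGroup (Fin s) ℝ ∧ Antitone σ ∧ (∀ j, 0 ≤ σ j) ∧
    Φ * Φᵀ = W * Matrix.diagonal (fun j => σ j ^ 2) * Wᵀ ∧
    ∀ i j, U i j = W i (Fin.castLE hrs j)

/-- The k-means objective on the rows of `U`. -/
noncomputable def kmeansCost {s r d : ℕ} (U : Matrix (Fin s) (Fin d) ℝ)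
    (Ω : Fin r → Finset (Fin s)) (c : Fin r → EuclideanSpace ℝ (Fin d)) : ℝ :=
  ∑ k, ∑ i ∈ Ω k, ‖WithLp.toLp 2 (U i) - c k‖ ^ 2

/-- `(Ω, c)` is a `(1 + ε)`-approximate solution of the k-means problem on the rows of `U`. -/
def IsApproxKMeans {s r d : ℕ} (ε : ℝ) (U : Matrix (Fin s) (Fin d) ℝ)
    (Ω : Fin r → Finset (Fin s)) (c : Fin r → EuclideanSpace ℝ (Fin d)) : Prop :=
  IsPartition Ω ∧
    ∀ (Ω' : Fin r → Finset (Fin s)) (c' : Fin r → EuclideanSpace ℝ (Fin d)),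
      IsPartition Ω' → kmeansCost U Ω c ≤ (1 + ε) * kmeansCost U Ω' c'

/-- The clustering steps of the reduction algorithm in the aggregatable case: `U` holds top `r`
left singular vectors of the feature matrix and `(Ωhat, c)` is a `(1 + ε)`-approximate k-means
solution on the rows of `U`. -/
structure IsAlgorithmOutput {n p s r : ℕ} (S : MJS n p s) (αA αB αT ε : ℝ)
    (U : Matrix (Fin s) (Fin r) ℝ) (Ωhat : Fin r → Finset (Fin s))
    (c : Fin r → EuclideanSpace ℝ (Fin r)) : Prop where
  singularVectors : IsTopLeftSingularVectors (featureMatrix S αA αB αT) U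
  kmeans : IsApproxKMeans ε U Ωhat c

/-- The misclustering rate, a minimum over all bijections of the cluster labels. -/
noncomputable def misclusteringRate {s r : ℕ} (Ω Ωhat : Fin r → Finset (Fin s)) : ℝ :=
  Finset.univ.inf' Finset.univ_nonempty fun h : Equiv.Perm (Fin r) =>
    ∑ k, ((Ω k \ Ωhat (h k)).card : ℝ) / ((Ω k).card : ℝ)

/-- The aggregate perturbation. -/
noncomputable def epsAgg (αA αB αT εA εB εT : ℝ) : ℝ :=
  √(αA ^ 2 * εA ^ 2 + αB ^ 2 * εB ^ 2 + αT ^ 2 * εT ^ 2)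

end MJSReduction

open MJSReduction

/-
Let `P` be the orthogonal projection that averages over the true clusters, so that the averaged
feature matrix is `P * Φ` and the aggregate perturbation bounds `‖Φ - P * Φ‖`. Among the
projections of rank `r`, the projection `U * Uᴴ` captures most of `Φ`, so
`‖(1 - U * Uᴴ) * Φ‖ ≤ ‖(1 - P) * Φ‖`; since `σ_r (P * Φ)` bounds `P * Φ` from below on the range
of `P`, this gives `‖(1 - U * Uᴴ) * P‖ ≤ 2 * ‖Φ - P * Φ‖ / σ_r (P * Φ)`. Multiplying by `Uᴴ` is an
isometry on rows, so the k-means solution on `U` yields a clustering of the rows of `P` of cost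
`O(‖(1 - U * Uᴴ) * P‖ ^ 2)`. Rows of `P` from the clusters `k ≠ l` are at squared distance
`1 / n_k + 1 / n_l`: a mode close to its center cannot share a cluster with a close mode of another
true cluster, and by Markov's inequality few modes are far from their center. A positive
misclustering rate is at least the inverse of the largest cluster size, so a rate below that
inverse vanishes.
-/

namespace MJSReduction

open Finset Module
open scoped Matrix

section Projections

variable {𝕜 m n : Type*} [RCLike 𝕜] [Fintype m] [Fintype n] {P : Matrix m m 𝕜}

theorem isStarProjection_mul_conjTranspose [DecidableEq n] {U : Matrix m n 𝕜}
    (hU : Uᴴ * U = 1) : IsStarProjection (U * Uᴴ) where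
  isIdempotentElem := by
    rw [IsIdempotentElem, Matrix.mul_assoc, ← Matrix.mul_assoc Uᴴ, hU, Matrix.one_mul]
  isSelfAdjoint := Matrix.isHermitian_mul_conjTranspose_self U

theorem isStarProjection_conjTranspose_mul_mul [DecidableEq m] {W : Matrix m n 𝕜}
    (hW : W * Wᴴ = 1) (hP : IsStarProjection P) : IsStarProjection (Wᴴ * P * W) where
  isIdempotentElem := by
    calc Wᴴ * P * W * (Wᴴ * P * W) = Wᴴ * (P * (W * Wᴴ) * P) * W := by simp only [Matrix.mul_assoc]
      _ = Wᴴ * P * W := by rw [hW, Matrix.mul_one, hP.isIdempotentElem.eq]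
  isSelfAdjoint := Matrix.isHermitian_conjTranspose_mul_mul W hP.isSelfAdjoint

theorem projection_mul_conjTranspose_self (hP : IsStarProjection P) : P * Pᴴ = P := by
  rw [← Matrix.star_eq_conjTranspose, hP.isSelfAdjoint.star_eq, hP.isIdempotentElem.eq]

theorem inner_row_row_of_isStarProjection (hP : IsStarProjection P) (i j : m) :
    inner 𝕜 (WithLp.toLp 2 (P i)) (WithLp.toLp 2 (P j)) = P j i := by
  conv_rhs => rw [← projection_mul_conjTranspose_self hP]
  simp [PiLp.inner_apply, Matrix.mul_apply]

open scoped ComplexOrder in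
theorem diag_mem_Icc_of_isStarProjection (hP : IsStarProjection P) (i : m) :
    P i i ∈ Set.Icc 0 1 := by
  classical
  have hdiag {R : Matrix m m 𝕜} (hR : IsStarProjection R) : 0 ≤ R i i :=
    projection_mul_conjTranspose_self hR ▸ (Matrix.posSemidef_self_mul_conjTranspose R).diag_nonneg
  exact ⟨hdiag hP, by simpa using hdiag hP.one_sub⟩

theorem trace_eq_rank_of_isIdempotentElem {K : Type*} [Field K] {R : Matrix m m K}
    (hR : IsIdempotentElem R) : R.trace = R.rank := by
  classical
  have hproj : LinearMap.IsProj R.toLin'.range R.toLin' :=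
    LinearMap.isProj_range_iff_isIdempotentElem _ |>.2 (hR.map (Matrix.toLinAlgEquiv' (R := K)))
  rw [← Matrix.trace_toLin'_eq, hproj.trace, Matrix.rank, Matrix.toLin'_apply']

end Projections

section Frobenius

open scoped Matrix.Norms.Frobenius

variable {𝕜 m n κ : Type*} [RCLike 𝕜] [Fintype m] [Fintype n] [Fintype κ]

theorem frobenius_norm_sq_eq_sum (M : Matrix m n 𝕜) : ‖M‖ ^ 2 = ∑ i, ∑ j, ‖M i j‖ ^ 2 := by
  rw [Matrix.frobenius_norm_def, ← Real.sqrt_eq_rpow, Real.sq_sqrt (by positivity)]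
  simp only [Real.rpow_two]

theorem frobenius_norm_sq_eq_sum_row (M : Matrix m n 𝕜) :
    ‖M‖ ^ 2 = ∑ i, ‖WithLp.toLp 2 (M i)‖ ^ 2 := by
  simp only [frobenius_norm_sq_eq_sum, EuclideanSpace.norm_sq_eq]

theorem frobenius_norm_sq_eq_re_trace (M : Matrix m n 𝕜) :
    ‖M‖ ^ 2 = RCLike.re (M * Mᴴ).trace := by
  simp only [frobenius_norm_sq_eq_sum, Matrix.trace, Matrix.diag_apply, Matrix.mul_apply,
    Matrix.conjTranspose_apply, RCLike.star_def, RCLike.mul_conj, ← RCLike.ofReal_pow, map_sum,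
    RCLike.ofReal_re]

theorem frobenius_norm_mul_conjTranspose [DecidableEq n] {U : Matrix m n 𝕜} (hU : Uᴴ * U = 1)
    (M : Matrix κ n 𝕜) : ‖M * Uᴴ‖ = ‖M‖ := by
  rw [← sq_eq_sq₀ (norm_nonneg _) (norm_nonneg _), frobenius_norm_sq_eq_re_trace,
    frobenius_norm_sq_eq_re_trace, Matrix.conjTranspose_mul, Matrix.conjTranspose_conjTranspose,
    Matrix.mul_assoc, ← Matrix.mul_assoc Uᴴ, hU, Matrix.one_mul]

variable {P Q : Matrix m m 𝕜}

theorem frobenius_norm_sq_projection_mul (hP : IsStarProjection P) (M : Matrix m n 𝕜) :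
    ‖P * M‖ ^ 2 = RCLike.re (P * (M * Mᴴ)).trace := by
  have hP' : Pᴴ = P := hP.isSelfAdjoint
  rw [frobenius_norm_sq_eq_re_trace, Matrix.conjTranspose_mul, hP', ← Matrix.mul_assoc,
    Matrix.trace_mul_comm, ← Matrix.mul_assoc, ← Matrix.mul_assoc, hP.isIdempotentElem.eq,
    Matrix.mul_assoc]

theorem frobenius_norm_sq_one_sub_projection_mul [DecidableEq m] (hP : IsStarProjection P)
    (M : Matrix m n 𝕜) : ‖(1 - P) * M‖ ^ 2 = ‖M‖ ^ 2 - RCLike.re (P * (M * Mᴴ)).trace := by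
  rw [frobenius_norm_sq_projection_mul hP.one_sub, Matrix.sub_mul, Matrix.one_mul,
    Matrix.trace_sub, map_sub, frobenius_norm_sq_eq_re_trace]

theorem frobenius_norm_one_sub_projection_mul_le [DecidableEq m] (hP : IsStarProjection P)
    (M : Matrix m n 𝕜) : ‖(1 - P) * M‖ ≤ ‖M‖ := by
  refine le_of_sq_le_sq ?_ (norm_nonneg _)
  rw [frobenius_norm_sq_one_sub_projection_mul hP, ← frobenius_norm_sq_projection_mul hP]
  exact sub_le_self _ (sq_nonneg _)

theorem frobenius_norm_sq_one_sub_projection_mul_projection [DecidableEq m]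
    (hP : IsStarProjection P) (hQ : IsStarProjection Q) :
    ‖(1 - P) * Q‖ ^ 2 = RCLike.re Q.trace - RCLike.re (P * Q).trace := by
  rw [frobenius_norm_sq_one_sub_projection_mul hP, frobenius_norm_sq_eq_re_trace,
    projection_mul_conjTranspose_self hQ]

theorem frobenius_norm_one_sub_projection_mul_projection_comm [DecidableEq m]
    (hP : IsStarProjection P) (hQ : IsStarProjection Q) (h : P.trace = Q.trace) :
    ‖(1 - P) * Q‖ = ‖(1 - Q) * P‖ := by
  rw [← sq_eq_sq₀ (norm_nonneg _) (norm_nonneg _),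
    frobenius_norm_sq_one_sub_projection_mul_projection hP hQ,
    frobenius_norm_sq_one_sub_projection_mul_projection hQ hP, h, Matrix.trace_mul_comm]

theorem frobenius_norm_sq_projection_sub_projection [DecidableEq m] (hP : IsStarProjection P)
    (hQ : IsStarProjection Q) (h : P.trace = Q.trace) :
    ‖P - Q‖ ^ 2 = 2 * ‖(1 - P) * Q‖ ^ 2 := by
  have hPQ : (P - Q)ᴴ = P - Q := (hP.isSelfAdjoint.sub hQ.isSelfAdjoint).star_eq
  rw [frobenius_norm_sq_eq_re_trace, hPQ, frobenius_norm_sq_one_sub_projection_mul_projection hP hQ,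
    Matrix.sub_mul, Matrix.mul_sub, Matrix.mul_sub, hP.isIdempotentElem.eq,
    hQ.isIdempotentElem.eq]
  simp only [Matrix.trace_sub, map_sub, h, Matrix.trace_mul_comm Q P]
  ring

end Frobenius

section SingularValues

variable {𝕜 E F : Type*} [RCLike 𝕜] [NormedAddCommGroup E] [InnerProductSpace 𝕜 E]
  [FiniteDimensional 𝕜 E] [NormedAddCommGroup F] [InnerProductSpace 𝕜 F] [FiniteDimensional 𝕜 F]

theorem eigenvectorBasis_repr_adjoint_apply (T : E →ₗ[𝕜] F) (x : E) (j : Fin (finrank 𝕜 E)) :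
    (T.isSymmetric_adjoint_comp_self.eigenvectorBasis rfl).repr (T.adjoint (T x)) j =
      (T.singularValues j ^ 2 : ℝ) *
        (T.isSymmetric_adjoint_comp_self.eigenvectorBasis rfl).repr x j := by
  rw [T.sq_singularValues_fin rfl]
  exact T.isSymmetric_adjoint_comp_self.eigenvectorBasis_apply_self_apply rfl x j

theorem singularValues_mul_norm_le_norm_adjoint (T : E →ₗ[𝕜] F) {y : F} (hy : y ∈ T.range) :
    T.singularValues (finrank 𝕜 T.range - 1) * ‖y‖ ≤ ‖T.adjoint y‖ := by
  obtain ⟨x, rfl⟩ := hy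
  let b := T.isSymmetric_adjoint_comp_self.eigenvectorBasis rfl
  have hnorm : ‖T x‖ ^ 2 = ∑ j : Fin _, T.singularValues j ^ 2 * ‖b.repr x j‖ ^ 2 := by
    rw [← inner_self_eq_norm_sq (𝕜 := 𝕜), ← LinearMap.adjoint_inner_right,
      ← b.repr.inner_map_map, PiLp.inner_apply, map_sum]
    refine sum_congr rfl fun j _ => ?_
    rw [eigenvectorBasis_repr_adjoint_apply, RCLike.inner_apply, mul_assoc, RCLike.mul_conj,
      RCLike.re_ofReal_mul, ← RCLike.ofReal_pow, RCLike.ofReal_re]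
  have hadj : ‖T.adjoint (T x)‖ ^ 2 =
      ∑ j : Fin _, T.singularValues j ^ 2 * (T.singularValues j ^ 2 * ‖b.repr x j‖ ^ 2) := by
    rw [← b.repr.norm_map, EuclideanSpace.norm_sq_eq]
    refine sum_congr rfl fun j _ => ?_
    rw [eigenvectorBasis_repr_adjoint_apply, norm_mul, RCLike.norm_ofReal, mul_pow, sq_abs]
    ring
  refine le_of_sq_le_sq ?_ (norm_nonneg _)
  rw [mul_pow, hnorm, hadj, mul_sum]
  refine sum_le_sum fun j _ => ?_
  by_cases hj : (j : ℕ) < finrank 𝕜 T.range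
  · gcongr
    · exact T.singularValues_nonneg _
    · exact T.singularValues_antitone (Nat.le_sub_one_of_lt hj)
  · simp [T.singularValues_eq_zero_iff_le_finrank_range.2 (not_lt.1 hj)]

variable {m n κ : Type*} [Fintype n] [Fintype κ] [DecidableEq κ]

theorem finrank_range_toEuclideanLin [Finite m] (M : Matrix m κ 𝕜) :
    finrank 𝕜 (Matrix.toEuclideanLin M).range = M.rank := by
  cases nonempty_fintype m
  rw [Matrix.toEuclideanLin_eq_toLin_orthonormal]
  exact (Matrix.rank_eq_finrank_range_toLin _ _ _).symm

variable [Fintype m]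

theorem range_toEuclideanLin_eq [DecidableEq m] {M : Matrix m κ 𝕜} {P : Matrix m m 𝕜}
    (hPM : P * M = M) (hrank : P.rank ≤ M.rank) :
    (Matrix.toEuclideanLin M).range = (Matrix.toEuclideanLin P).range := by
  refine Submodule.eq_of_le_of_finrank_le ?_ (by simpa only [finrank_range_toEuclideanLin])
  rintro _ ⟨x, rfl⟩
  refine ⟨Matrix.toEuclideanLin M x, ?_⟩
  simp [Matrix.toLpLin_apply, hPM]

open scoped Matrix.Norms.Frobenius in
theorem singularValues_mul_frobenius_norm_le (M : Matrix m κ 𝕜)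
    {P : Matrix m m 𝕜} (hP : P.IsHermitian) (hPM : P * M = M) (hrank : P.rank ≤ M.rank)
    (Y : Matrix m n 𝕜) :
    (Matrix.toEuclideanLin M).singularValues (M.rank - 1) * ‖P * Y‖ ≤ ‖Mᴴ * Y‖ := by
  classical
  have hMP : Mᴴ * P = Mᴴ := by
    conv_rhs => rw [← hPM, Matrix.conjTranspose_mul, hP.eq]
  have hcol (j : n) :
      (Matrix.toEuclideanLin M).singularValues (M.rank - 1) * ‖WithLp.toLp 2 (P *ᵥ Yᵀ j)‖ ≤
        ‖WithLp.toLp 2 (Mᴴ *ᵥ Yᵀ j)‖ := by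
    have hmem : WithLp.toLp 2 (P *ᵥ Yᵀ j) ∈ (Matrix.toEuclideanLin M).range :=
      range_toEuclideanLin_eq hPM hrank ▸ ⟨WithLp.toLp 2 (Yᵀ j), rfl⟩
    have h := singularValues_mul_norm_le_norm_adjoint _ hmem
    rwa [finrank_range_toEuclideanLin, ← Matrix.toEuclideanLin_conjTranspose_eq_adjoint,
      Matrix.toLpLin_toLp, Matrix.toLin'_apply, Matrix.mulVec_mulVec, hMP] at h
  refine le_of_sq_le_sq ?_ (norm_nonneg _)
  rw [← Matrix.frobenius_norm_transpose, ← Matrix.frobenius_norm_transpose (Mᴴ * Y), mul_pow,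
    frobenius_norm_sq_eq_sum_row, frobenius_norm_sq_eq_sum_row, mul_sum]
  refine sum_le_sum fun j _ => ?_
  rw [← mul_pow]
  exact pow_le_pow_left₀
    (mul_nonneg ((Matrix.toEuclideanLin M).singularValues_nonneg _) (norm_nonneg _)) (hcol j) 2

end SingularValues

section TopSingularVectors

open scoped Matrix.Norms.Frobenius

theorem sum_mul_le_sum_of_threshold {ι R : Type*} [Fintype ι] [CommRing R] [LinearOrder R]
    [IsStrictOrderedRing R] {S : Finset ι} {D g : ι → R} {θ : R} (hS : ∀ j ∈ S, θ ≤ D j)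
    (hSc : ∀ j ∉ S, D j ≤ θ) (hg : ∀ j, g j ∈ Set.Icc 0 1) (hsum : ∑ j, g j = #S) :
    ∑ j, D j * g j ≤ ∑ j ∈ S, D j := by
  classical
  have hterm (j : ι) : (D j - θ) * g j ≤ if j ∈ S then D j - θ else 0 := by
    split_ifs with hj
    · exact mul_le_of_le_one_right (sub_nonneg.2 (hS j hj)) (hg j).2
    · exact mul_nonpos_of_nonpos_of_nonneg (sub_nonpos.2 (hSc j hj)) (hg j).1
  have h := sum_le_sum fun j (_ : j ∈ univ) => hterm j
  simp only [sub_mul, sum_sub_distrib, ← mul_sum, hsum, sum_ite_mem, univ_inter, sum_const,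
    nsmul_eq_mul] at h
  linarith

theorem trace_mul_conj_diagonal {m : Type*} [Fintype m] [DecidableEq m] {R : Type*} [CommRing R]
    (Q V W : Matrix m m R) (D : m → R) :
    (Q * (V * Matrix.diagonal D * W)).trace = ∑ j, D j * (W * Q * V) j j := by
  rw [← Matrix.mul_assoc, Matrix.trace_mul_comm, ← Matrix.mul_assoc, ← Matrix.mul_assoc]
  simp [Matrix.trace, Matrix.mul_diagonal, mul_comm]

variable {s r : ℕ} {κ : Type*} [Fintype κ] {Φ : Matrix (Fin s) κ ℝ} {U : Matrix (Fin s) (Fin r) ℝ}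

theorem IsTopLeftSingularVectors.conjTranspose_mul_self (h : IsTopLeftSingularVectors Φ U) :
    Uᴴ * U = 1 := by
  obtain ⟨W, σ, hrs, hW, -, -, -, hU⟩ := h
  obtain rfl : U = W.submatrix id (Fin.castLE hrs) := Matrix.ext hU
  rw [Matrix.conjTranspose_submatrix, ← Matrix.submatrix_mul _ _ _ _ _ Function.bijective_id,
    Matrix.conjTranspose_eq_transpose_of_trivial, (Matrix.mem_orthogonalGroup_iff' _ _).1 hW,
    Matrix.submatrix_one _ (Fin.castLE_injective hrs)]

theorem exists_threshold_castLE {D : Fin s → ℝ} (hD : Antitone D) (h0 : ∀ j, 0 ≤ D j)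
    (hrs : r ≤ s) :
    ∃ θ, (∀ j ∈ univ.map (Fin.castLEEmb hrs), θ ≤ D j) ∧
      ∀ j ∉ univ.map (Fin.castLEEmb hrs), D j ≤ θ := by
  have hmem (j : Fin s) : j ∈ univ.map (Fin.castLEEmb hrs) ↔ (j : ℕ) < r := by
    simp only [mem_map, mem_univ, true_and]
    exact ⟨fun ⟨k, hk⟩ => hk ▸ k.2, fun hj => ⟨⟨j, hj⟩, rfl⟩⟩
  simp only [hmem, not_lt]
  rcases hrs.lt_or_eq with hlt | rfl
  · exact ⟨D ⟨r, hlt⟩, fun j hj => hD hj.le, fun j hj => hD hj⟩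
  · exact ⟨0, fun j _ => h0 j, fun j hj => absurd j.2 hj.not_gt⟩

theorem sum_mul_diag_submatrix_one {m n R : Type*} [Fintype m] [DecidableEq m] [Fintype n]
    [CommSemiring R] (f : n ↪ m) (D : m → R) :
    ∑ j, D j * ((1 : Matrix m m R).submatrix id f * (1 : Matrix m m R).submatrix f id) j j =
      ∑ j ∈ univ.map f, D j := by
  simp only [Matrix.mul_apply, Matrix.submatrix_apply, mul_sum, sum_map]
  rw [sum_comm]
  simp [Matrix.one_apply]

theorem IsTopLeftSingularVectors.trace_mul_le (h : IsTopLeftSingularVectors Φ U)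
    {Q : Matrix (Fin s) (Fin s) ℝ} (hQ : IsStarProjection Q) (htr : Q.trace = r) :
    (Q * (Φ * Φᴴ)).trace ≤ (U * Uᴴ * (Φ * Φᴴ)).trace := by
  obtain ⟨W, σ, hrs, hW, hσ, hσ0, hΦ, hU⟩ := h
  obtain rfl : U = W.submatrix id (Fin.castLEEmb hrs) := Matrix.ext hU
  have hWW : W * Wᴴ = 1 := (Matrix.mem_orthogonalGroup_iff _ _).1 hW
  have hWW' : Wᴴ * W = 1 := (Matrix.mem_orthogonalGroup_iff' _ _).1 hW
  have hWUUW : Wᴴ * (W.submatrix id (Fin.castLEEmb hrs) *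
      (W.submatrix id (Fin.castLEEmb hrs))ᴴ) * W =
      (1 : Matrix (Fin s) (Fin s) ℝ).submatrix id (Fin.castLEEmb hrs) *
        (1 : Matrix (Fin s) (Fin s) ℝ).submatrix (Fin.castLEEmb hrs) id := by
    rw [← hWW', ← Matrix.submatrix_mul_equiv Wᴴ W id (Equiv.refl _),
      ← Matrix.submatrix_mul_equiv Wᴴ W _ (Equiv.refl _) id, Matrix.conjTranspose_submatrix]
    simp [Matrix.mul_assoc]
  have hdiag := diag_mem_Icc_of_isStarProjection (isStarProjection_conjTranspose_mul_mul hWW hQ)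
  have hsum : ∑ j, (Wᴴ * Q * W) j j = #(univ.map (Fin.castLEEmb hrs)) := by
    calc (Wᴴ * Q * W).trace = (W * Wᴴ * Q).trace := by
          rw [Matrix.trace_mul_comm, Matrix.mul_assoc]
      _ = #(univ.map (Fin.castLEEmb hrs)) := by
          rw [hWW, Matrix.one_mul, htr, card_map, card_univ, Fintype.card_fin]
  obtain ⟨θ, hθ, hθ'⟩ := exists_threshold_castLE (D := fun j => σ j ^ 2)
    (fun i j hij => pow_le_pow_left₀ (hσ0 j) (hσ hij) 2) (fun j => sq_nonneg _) hrs
  rw [Matrix.conjTranspose_eq_transpose_of_trivial Φ, hΦ,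
    ← Matrix.conjTranspose_eq_transpose_of_trivial W, trace_mul_conj_diagonal,
    trace_mul_conj_diagonal, hWUUW, sum_mul_diag_submatrix_one]
  exact sum_mul_le_sum_of_threshold hθ hθ' hdiag hsum

theorem IsTopLeftSingularVectors.norm_one_sub_mul_le (h : IsTopLeftSingularVectors Φ U)
    {Q : Matrix (Fin s) (Fin s) ℝ} (hQ : IsStarProjection Q) (htr : Q.trace = r) :
    ‖(1 - U * Uᴴ) * Φ‖ ≤ ‖(1 - Q) * Φ‖ := by
  refine le_of_sq_le_sq ?_ (norm_nonneg _)
  rw [frobenius_norm_sq_one_sub_projection_mul hQ, frobenius_norm_sq_one_sub_projection_mul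
    (isStarProjection_mul_conjTranspose h.conjTranspose_mul_self)]
  exact sub_le_sub_left (h.trace_mul_le hQ htr) _

theorem singularValue_pos [DecidableEq κ] {M : Matrix (Fin s) κ ℝ} (hM : M.rank = r)
    (hr : 0 < r) : 0 < singularValue M r := by
  rw [singularValue, LinearMap.singularValues_pos_iff_lt_finrank_range,
    finrank_range_toEuclideanLin, hM]
  exact Nat.sub_one_lt hr.ne'

theorem IsTopLeftSingularVectors.singularValue_mul_norm_le [DecidableEq κ]
    (h : IsTopLeftSingularVectors Φ U) {P : Matrix (Fin s) (Fin s) ℝ} (hP : IsStarProjection P)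
    (htr : P.trace = r) (hrank : (P * Φ).rank = r) :
    singularValue (P * Φ) r * ‖(1 - U * Uᴴ) * P‖ ≤ 2 * ‖Φ - P * Φ‖ := by
  have hPr : P.rank = r := by
    exact_mod_cast (trace_eq_rank_of_isIdempotentElem hP.isIdempotentElem).symm.trans htr
  have hUU := isStarProjection_mul_conjTranspose h.conjTranspose_mul_self
  set R := 1 - U * Uᴴ
  have hR : Rᴴ = R := hUU.one_sub.isSelfAdjoint
  have hP' : Pᴴ = P := hP.isSelfAdjoint
  have hσ : singularValue (P * Φ) r * ‖R * P‖ ≤ ‖R * (P * Φ)‖ := by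
    have := singularValues_mul_frobenius_norm_le (P * Φ) (P := P) hP'
      (by rw [← Matrix.mul_assoc, hP.isIdempotentElem.eq]) (hPr.trans hrank.symm).le R
    rwa [hrank, ← Matrix.frobenius_norm_conjTranspose (P * R), Matrix.conjTranspose_mul, hP', hR,
      ← Matrix.frobenius_norm_conjTranspose ((P * Φ)ᴴ * R), Matrix.conjTranspose_mul, hR,
      Matrix.conjTranspose_conjTranspose] at this
  calc singularValue (P * Φ) r * ‖R * P‖ ≤ ‖R * (P * Φ)‖ := hσ
    _ = ‖R * Φ - R * (Φ - P * Φ)‖ := by rw [← Matrix.mul_sub, sub_sub_cancel]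
    _ ≤ ‖R * Φ‖ + ‖R * (Φ - P * Φ)‖ := norm_sub_le _ _
    _ ≤ ‖(1 - P) * Φ‖ + ‖Φ - P * Φ‖ :=
        add_le_add (h.norm_one_sub_mul_le hP htr)
          (frobenius_norm_one_sub_projection_mul_le hUU _)
    _ = 2 * ‖Φ - P * Φ‖ := by rw [Matrix.sub_mul, Matrix.one_mul, two_mul]

end TopSingularVectors

section Partition

variable {s r : ℕ} {Ω : Fin r → Finset (Fin s)}

theorem card_le_maxClusterCard (Ω : Fin r → Finset (Fin s)) (k : Fin r) :
    #(Ω k) ≤ maxClusterCard Ω :=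
  le_ciSup (Set.finite_range fun k => #(Ω k)).bddAbove k

theorem minClusterCard_le_card (Ω : Fin r → Finset (Fin s)) (k : Fin r) :
    minClusterCard Ω ≤ #(Ω k) :=
  ciInf_le (Set.finite_range fun k => #(Ω k)).bddBelow k

namespace IsPartition

/-- The index of the cluster that contains `i`. -/
noncomputable def label (hΩ : IsPartition Ω) (i : Fin s) : Fin r :=
  (hΩ.cover i).choose

theorem mem_iff_label_eq (hΩ : IsPartition Ω) {i : Fin s} {k : Fin r} :
    i ∈ Ω k ↔ hΩ.label i = k := by
  have hmem : i ∈ Ω (hΩ.label i) := (hΩ.cover i).choose_spec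
  refine ⟨fun hk => ?_, fun hk => hk ▸ hmem⟩
  by_contra hne
  exact disjoint_left.1 (hΩ.disjoint _ _ hne) hmem hk

theorem sum_sum_eq (hΩ : IsPartition Ω) {M : Type*} [AddCommMonoid M] (f : Fin s → M) :
    ∑ k, ∑ i ∈ Ω k, f i = ∑ i, f i := by
  rw [← sum_biUnion fun k _ l _ h => hΩ.disjoint k l h]
  congr 1
  ext i
  simpa using hΩ.cover i

theorem cast_card_pos (hΩ : IsPartition Ω) (k : Fin r) : (0 : ℝ) < #(Ω k) :=
  Nat.cast_pos.2 (hΩ.nonempty k).card_pos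

theorem cast_maxClusterCard_pos (hΩ : IsPartition Ω) (k : Fin r) : (0 : ℝ) < maxClusterCard Ω :=
  (hΩ.cast_card_pos k).trans_le (Nat.cast_le.2 (card_le_maxClusterCard Ω k))

theorem inv_maxClusterCard_le_inv_card (hΩ : IsPartition Ω) (k : Fin r) :
    (maxClusterCard Ω : ℝ)⁻¹ ≤ (#(Ω k) : ℝ)⁻¹ :=
  inv_anti₀ (hΩ.cast_card_pos k) (Nat.cast_le.2 (card_le_maxClusterCard Ω k))

theorem averagedMatrix_apply (hΩ : IsPartition Ω) {κ : Type*} (Φ : Matrix (Fin s) κ ℝ)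
    (i : Fin s) (j : κ) :
    averagedMatrix Ω Φ i j = (#(Ω (hΩ.label i)) : ℝ)⁻¹ * ∑ i' ∈ Ω (hΩ.label i), Φ i' j := by
  simp [averagedMatrix, hΩ.mem_iff_label_eq]

open scoped Matrix.Norms.Frobenius in
theorem frobenius_norm_sub_averagedMatrix_sq_le (hΩ : IsPartition Ω) {κ : Type*} [Fintype κ]
    (Φ : Matrix (Fin s) κ ℝ) :
    ‖Φ - averagedMatrix Ω Φ‖ ^ 2 ≤ ∑ k, ∑ i ∈ Ω k, ∑ i' ∈ Ω k, ∑ j, (Φ i j - Φ i' j) ^ 2 := by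
  rw [frobenius_norm_sq_eq_sum, ← hΩ.sum_sum_eq]
  refine sum_le_sum fun k _ => sum_le_sum fun i hi => ?_
  rw [sum_comm]
  refine sum_le_sum fun j _ => ?_
  have hone : (1 : ℝ) ≤ #(Ω k) := Nat.one_le_cast.2 (hΩ.nonempty k).card_pos
  have hentry : #(Ω k) * (Φ - averagedMatrix Ω Φ) i j = ∑ i' ∈ Ω k, (Φ i j - Φ i' j) := by
    rw [Matrix.sub_apply, hΩ.averagedMatrix_apply, hΩ.mem_iff_label_eq.1 hi, sum_sub_distrib,
      sum_const, nsmul_eq_mul, mul_sub, mul_inv_cancel_left₀ (hΩ.cast_card_pos k).ne']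
  have hCS : #(Ω k) * ‖(Φ - averagedMatrix Ω Φ) i j‖ ^ 2 ≤ ∑ i' ∈ Ω k, (Φ i j - Φ i' j) ^ 2 := by
    refine le_of_mul_le_mul_left ?_ (hΩ.cast_card_pos k)
    calc #(Ω k) * (#(Ω k) * ‖(Φ - averagedMatrix Ω Φ) i j‖ ^ 2)
        = (∑ i' ∈ Ω k, (Φ i j - Φ i' j)) ^ 2 := by rw [← hentry, Real.norm_eq_abs, sq_abs]; ring
      _ ≤ #(Ω k) * ∑ i' ∈ Ω k, (Φ i j - Φ i' j) ^ 2 := sq_sum_le_card_mul_sum_sq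
  exact (le_mul_of_one_le_left (sq_nonneg _) hone).trans hCS

end IsPartition

/-- The matrix averaging a vector over the clusters; for a partition it is the orthogonal
projection onto the span of the indicator vectors of the clusters. -/
noncomputable def clusterProjection (Ω : Fin r → Finset (Fin s)) : Matrix (Fin s) (Fin s) ℝ :=
  averagedMatrix Ω 1

theorem clusterProjection_mul (Ω : Fin r → Finset (Fin s)) {κ : Type*}
    (Φ : Matrix (Fin s) κ ℝ) : clusterProjection Ω * Φ = averagedMatrix Ω Φ := by
  ext i j
  simp only [clusterProjection, averagedMatrix, Matrix.mul_apply, Matrix.of_apply, sum_mul]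
  rw [sum_comm]
  refine sum_congr rfl fun k _ => ?_
  simp [ite_mul, ← mul_sum, Matrix.one_apply]

namespace IsPartition

theorem clusterProjection_apply (hΩ : IsPartition Ω) (i j : Fin s) :
    clusterProjection Ω i j =
      if hΩ.label i = hΩ.label j then (#(Ω (hΩ.label i)) : ℝ)⁻¹ else 0 := by
  simp [clusterProjection, hΩ.averagedMatrix_apply, Matrix.one_apply, hΩ.mem_iff_label_eq,
    eq_comm]

theorem isStarProjection_clusterProjection (hΩ : IsPartition Ω) :
    IsStarProjection (clusterProjection Ω) where
  isIdempotentElem := by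
    ext i j
    have hconst : ∀ i' ∈ Ω (hΩ.label i), clusterProjection Ω i' j = clusterProjection Ω i j := by
      intro i' hi'
      rw [hΩ.clusterProjection_apply, hΩ.clusterProjection_apply, hΩ.mem_iff_label_eq.1 hi']
    rw [clusterProjection_mul, hΩ.averagedMatrix_apply, sum_congr rfl hconst, sum_const,
      nsmul_eq_mul, inv_mul_cancel_left₀ (hΩ.cast_card_pos _).ne']
  isSelfAdjoint := by
    ext i j
    rw [Matrix.star_apply, star_trivial, hΩ.clusterProjection_apply, hΩ.clusterProjection_apply]
    grind

theorem trace_clusterProjection (hΩ : IsPartition Ω) : (clusterProjection Ω).trace = r := by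
  have hcluster (k : Fin r) : ∑ i ∈ Ω k, clusterProjection Ω i i = 1 := by
    rw [← mul_inv_cancel₀ (hΩ.cast_card_pos k).ne', ← nsmul_eq_mul, ← sum_const]
    refine sum_congr rfl fun i hi => ?_
    rw [hΩ.clusterProjection_apply, if_pos rfl, hΩ.mem_iff_label_eq.1 hi]
  simp only [Matrix.trace, Matrix.diag_apply, ← hΩ.sum_sum_eq, hcluster, sum_const, card_univ,
    Fintype.card_fin, nsmul_one]

theorem dist_clusterProjection_sq (hΩ : IsPartition Ω) {i j : Fin s}
    (hij : hΩ.label i ≠ hΩ.label j) :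
    dist (WithLp.toLp 2 (clusterProjection Ω i)) (WithLp.toLp 2 (clusterProjection Ω j)) ^ 2 =
      (#(Ω (hΩ.label i)) : ℝ)⁻¹ + (#(Ω (hΩ.label j)) : ℝ)⁻¹ := by
  have hP := hΩ.isStarProjection_clusterProjection
  rw [dist_eq_norm, norm_sub_sq_real, ← real_inner_self_eq_norm_sq, ← real_inner_self_eq_norm_sq]
  simp only [inner_row_row_of_isStarProjection hP, hΩ.clusterProjection_apply, if_true,
    if_neg hij.symm, mul_zero, sub_zero]

end IsPartition

end Partition

section KMeans

open scoped Matrix.Norms.Frobenius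

variable {s r d : ℕ} {Ω : Fin r → Finset (Fin s)}

/-- The matrix whose `i`-th row is the center of the cluster that contains `i`. -/
noncomputable def IsPartition.centerMatrix (hΩ : IsPartition Ω)
    (c : Fin r → EuclideanSpace ℝ (Fin d)) : Matrix (Fin s) (Fin d) ℝ :=
  Matrix.of fun i => (c (hΩ.label i)).ofLp

theorem IsPartition.kmeansCost_eq_sum (hΩ : IsPartition Ω) (U : Matrix (Fin s) (Fin d) ℝ)
    (c : Fin r → EuclideanSpace ℝ (Fin d)) :
    kmeansCost U Ω c = ∑ i, dist (WithLp.toLp 2 (U i)) (c (hΩ.label i)) ^ 2 := by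
  rw [kmeansCost, ← hΩ.sum_sum_eq]
  refine sum_congr rfl fun k _ => sum_congr rfl fun i hi => ?_
  rw [hΩ.mem_iff_label_eq.1 hi, dist_eq_norm]

theorem IsPartition.kmeansCost_eq_norm_sq (hΩ : IsPartition Ω) (U : Matrix (Fin s) (Fin d) ℝ)
    (c : Fin r → EuclideanSpace ℝ (Fin d)) :
    kmeansCost U Ω c = ‖U - hΩ.centerMatrix c‖ ^ 2 := by
  rw [hΩ.kmeansCost_eq_sum, frobenius_norm_sq_eq_sum_row]
  simp only [dist_eq_norm]
  rfl

theorem IsPartition.exists_centerMatrix_eq_averagedMatrix (hΩ : IsPartition Ω)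
    (U : Matrix (Fin s) (Fin d) ℝ) : ∃ c, hΩ.centerMatrix c = averagedMatrix Ω U := by
  refine ⟨fun k => WithLp.toLp 2 fun j => (#(Ω k) : ℝ)⁻¹ * ∑ i ∈ Ω k, U i j, ?_⟩
  ext i j
  rw [hΩ.averagedMatrix_apply]
  rfl

theorem IsPartition.centerMatrix_mul_conjTranspose (hΩ : IsPartition Ω) {t : ℕ}
    (c : Fin r → EuclideanSpace ℝ (Fin d)) (V : Matrix (Fin t) (Fin d) ℝ) :
    hΩ.centerMatrix c * Vᴴ = hΩ.centerMatrix fun k => WithLp.toLp 2 (V *ᵥ (c k).ofLp) := by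
  ext i j
  simp [centerMatrix, Matrix.mul_apply, Matrix.mulVec, dotProduct, mul_comm]

theorem IsApproxKMeans.kmeansCost_le_averagedMatrix {ε : ℝ} {U : Matrix (Fin s) (Fin d) ℝ}
    {Ωhat : Fin r → Finset (Fin s)} {c : Fin r → EuclideanSpace ℝ (Fin d)}
    (hc : IsApproxKMeans ε U Ωhat c) (hΩ : IsPartition Ω) :
    kmeansCost U Ωhat c ≤ (1 + ε) * ‖U - averagedMatrix Ω U‖ ^ 2 := by
  obtain ⟨c', hc'⟩ := hΩ.exists_centerMatrix_eq_averagedMatrix U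
  rw [← hc', ← hΩ.kmeansCost_eq_norm_sq]
  exact hc.2 Ω c' hΩ

theorem IsApproxKMeans.kmeansCost_clusterProjection_le {ε : ℝ} {U : Matrix (Fin s) (Fin r) ℝ}
    {Ωhat : Fin r → Finset (Fin s)} {c : Fin r → EuclideanSpace ℝ (Fin r)}
    (hc : IsApproxKMeans ε U Ωhat c) (hε : 0 ≤ ε) (hU : Uᴴ * U = 1) (hΩ : IsPartition Ω) :
    kmeansCost (clusterProjection Ω) Ωhat (fun k => WithLp.toLp 2 (U *ᵥ (c k).ofLp)) ≤
      3 * (2 + ε) * ‖(1 - U * Uᴴ) * clusterProjection Ω‖ ^ 2 := by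
  have hP := hΩ.isStarProjection_clusterProjection
  have hUU := isStarProjection_mul_conjTranspose hU
  have htr : (U * Uᴴ).trace = (clusterProjection Ω).trace := by
    rw [Matrix.trace_mul_comm, hU, Matrix.trace_one, Fintype.card_fin, hΩ.trace_clusterProjection]
  have hcost : ‖U - hc.1.centerMatrix c‖ ^ 2 ≤
      (1 + ε) * ‖(1 - U * Uᴴ) * clusterProjection Ω‖ ^ 2 := by
    rw [← hc.1.kmeansCost_eq_norm_sq,
      frobenius_norm_one_sub_projection_mul_projection_comm hUU hP htr, ← Matrix.mul_assoc,
      frobenius_norm_mul_conjTranspose hU, Matrix.sub_mul, Matrix.one_mul, clusterProjection_mul]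
    exact hc.kmeansCost_le_averagedMatrix hΩ
  have hproj := frobenius_norm_sq_projection_sub_projection hUU hP htr
  rw [hc.1.kmeansCost_eq_norm_sq, ← hc.1.centerMatrix_mul_conjTranspose]
  calc ‖clusterProjection Ω - hc.1.centerMatrix c * Uᴴ‖ ^ 2
      = ‖(U - hc.1.centerMatrix c) * Uᴴ - (U * Uᴴ - clusterProjection Ω)‖ ^ 2 := by
        rw [Matrix.sub_mul, sub_sub_sub_cancel_left]
    _ ≤ (‖(U - hc.1.centerMatrix c) * Uᴴ‖ + ‖U * Uᴴ - clusterProjection Ω‖) ^ 2 := by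
        gcongr
        exact norm_sub_le _ _
    _ ≤ 2 * (‖(U - hc.1.centerMatrix c) * Uᴴ‖ ^ 2 + ‖U * Uᴴ - clusterProjection Ω‖ ^ 2) :=
        add_sq_le
    _ ≤ 3 * (2 + ε) * ‖(1 - U * Uᴴ) * clusterProjection Ω‖ ^ 2 := by
        rw [frobenius_norm_mul_conjTranspose hU, hproj]
        nlinarith [mul_nonneg hε (sq_nonneg ‖(1 - U * Uᴴ) * clusterProjection Ω‖)]

end KMeans

section Misclustering

theorem exists_perm_of_separated {ι α : Type*} [Finite ι] {G : ι → Set α} {f : α → ι}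
    (hne : ∀ k, (G k).Nonempty) (hsep : ∀ k l, ∀ i ∈ G k, ∀ j ∈ G l, f i = f j → k = l) :
    ∃ h : Equiv.Perm ι, ∀ k, ∀ i ∈ G k, f i = h k := by
  choose t ht using hne
  have hinj : Function.Injective fun k => f (t k) := fun k l h => hsep k l _ (ht k) _ (ht l) h
  refine ⟨Equiv.ofBijective _ (Finite.injective_iff_bijective.1 hinj), fun k i hi => ?_⟩
  obtain ⟨l, hl⟩ := Finite.surjective_of_injective hinj (f i)
  rw [Equiv.ofBijective_apply, ← hl, hsep k l i hi (t l) (ht l) hl.symm]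

theorem card_filter_le_mul_le_sum {ι R : Type*} [CommRing R] [LinearOrder R]
    [IsStrictOrderedRing R] {A : Finset ι} {D : ι → R} (hD : ∀ i ∈ A, 0 ≤ D i) (t : R) :
    #{i ∈ A | t ≤ D i} * t ≤ ∑ i ∈ A, D i := by
  rw [← nsmul_eq_mul]
  exact (card_nsmul_le_sum _ _ _ fun i hi => (mem_filter.1 hi).2).trans
    (sum_le_sum_of_subset_of_nonneg (filter_subset _ _) fun i hi _ => hD i hi)

theorem dist_sq_le_two_mul_add {E : Type*} [PseudoMetricSpace E] (x y z : E) :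
    dist x y ^ 2 ≤ 2 * (dist x z ^ 2 + dist y z ^ 2) :=
  (pow_le_pow_left₀ dist_nonneg (dist_triangle_right x y z) 2).trans add_sq_le

variable {s r : ℕ} {Ω Ωhat : Fin r → Finset (Fin s)}

theorem IsPartition.misclusteringRate_eq_zero_of_lt (hΩ : IsPartition Ω)
    (h : misclusteringRate Ω Ωhat < (maxClusterCard Ω : ℝ)⁻¹) : misclusteringRate Ω Ωhat = 0 := by
  obtain ⟨g, -, hg⟩ := exists_mem_eq_inf' univ_nonempty fun h : Equiv.Perm (Fin r) =>
    ∑ k, (#(Ω k \ Ωhat (h k)) : ℝ) / #(Ω k)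
  have hMR : misclusteringRate Ω Ωhat = ∑ k, (#(Ω k \ Ωhat (g k)) : ℝ) / #(Ω k) := hg
  have hcard (k : Fin r) : #(Ω k \ Ωhat (g k)) = 0 := by
    by_contra hne
    have hone : (1 : ℝ) ≤ #(Ω k \ Ωhat (g k)) := Nat.one_le_cast.2 (Nat.pos_of_ne_zero hne)
    refine h.not_ge ?_
    calc (maxClusterCard Ω : ℝ)⁻¹ ≤ (#(Ω k) : ℝ)⁻¹ := hΩ.inv_maxClusterCard_le_inv_card k
      _ ≤ #(Ω k \ Ωhat (g k)) / #(Ω k) := by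
        rw [div_eq_mul_inv]
        exact le_mul_of_one_le_left (by positivity) hone
      _ ≤ misclusteringRate Ω Ωhat := by
        rw [hMR]
        exact single_le_sum (f := fun k => (#(Ω k \ Ωhat (g k)) : ℝ) / #(Ω k))
          (fun _ _ => by positivity) (mem_univ k)
  simp [hMR, hcard]

theorem misclusteringRate_le_of_subset {B : Fin r → Finset (Fin s)} (h : Equiv.Perm (Fin r))
    (hB : ∀ k, Ω k \ Ωhat (h k) ⊆ B k) :
    misclusteringRate Ω Ωhat ≤ ∑ k, (#(B k) : ℝ) * (#(Ω k) : ℝ)⁻¹ := by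
  refine (inf'_le _ (mem_univ h)).trans (sum_le_sum fun k _ => ?_)
  rw [div_eq_mul_inv]
  gcongr
  exact hB k

theorem IsPartition.add_div_le_card_mul_add (hΩ : IsPartition Ω) (k : Fin r) :
    ((minClusterCard Ω : ℝ) + maxClusterCard Ω) / maxClusterCard Ω ≤
      #(Ω k) * ((#(Ω k) : ℝ)⁻¹ + (maxClusterCard Ω : ℝ)⁻¹) := by
  have hmin : (minClusterCard Ω : ℝ) ≤ #(Ω k) := Nat.cast_le.2 (minClusterCard_le_card Ω k)
  rw [mul_add, mul_inv_cancel₀ (hΩ.cast_card_pos k).ne', add_div,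
    div_self (hΩ.cast_maxClusterCard_pos k).ne', add_comm, div_eq_mul_inv]
  gcongr

theorem IsPartition.exists_mem_lt_of_sum_lt (hΩ : IsPartition Ω) {D : Fin s → ℝ}
    (hD : ∀ i, 0 ≤ D i)
    (hsum : ∑ i, D i < ((minClusterCard Ω : ℝ) + maxClusterCard Ω) / maxClusterCard Ω)
    (k : Fin r) : ∃ i ∈ Ω k, D i < (#(Ω k) : ℝ)⁻¹ + (maxClusterCard Ω : ℝ)⁻¹ := by
  by_contra! hall
  refine hsum.not_ge ((hΩ.add_div_le_card_mul_add k).trans ?_)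
  rw [← nsmul_eq_mul]
  exact (card_nsmul_le_sum _ _ _ hall).trans
    (sum_le_sum_of_subset_of_nonneg (subset_univ _) fun i _ _ => hD i)

theorem IsPartition.misclusteringRate_le_of_separated {E : Type*} [PseudoMetricSpace E]
    (hΩ : IsPartition Ω) (hhat : IsPartition Ωhat) {x : Fin s → E} {y : Fin r → E}
    (hsep : ∀ i j, hΩ.label i ≠ hΩ.label j →
      (#(Ω (hΩ.label i)) : ℝ)⁻¹ + (#(Ω (hΩ.label j)) : ℝ)⁻¹ ≤ dist (x i) (x j) ^ 2)
    (hsum : 4 * ∑ i, dist (x i) (y (hhat.label i)) ^ 2 <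
      ((minClusterCard Ω : ℝ) + maxClusterCard Ω) / maxClusterCard Ω) :
    misclusteringRate Ω Ωhat ≤ 4 * ∑ i, dist (x i) (y (hhat.label i)) ^ 2 := by
  set D : Fin s → ℝ := fun i => 4 * dist (x i) (y (hhat.label i)) ^ 2
  let w : Fin r → ℝ := fun k => (#(Ω k) : ℝ)⁻¹ + (maxClusterCard Ω : ℝ)⁻¹
  have hD (i : Fin s) : 0 ≤ D i := by positivity
  have hmarkov : ∑ k, (#{i ∈ Ω k | w k ≤ D i} : ℝ) * w k ≤ ∑ i, D i := by
    rw [← hΩ.sum_sum_eq]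
    exact sum_le_sum fun k _ => card_filter_le_mul_le_sum (fun i _ => hD i) _
  rw [mul_sum] at hsum ⊢
  have hgood (k : Fin r) : {i | i ∈ Ω k ∧ D i < w k}.Nonempty :=
    hΩ.exists_mem_lt_of_sum_lt hD hsum k
  have hlabel (k l : Fin r) : ∀ i ∈ {i | i ∈ Ω k ∧ D i < w k}, ∀ j ∈ {i | i ∈ Ω l ∧ D i < w l},
      hhat.label i = hhat.label j → k = l := by
    rintro i ⟨hi, hDi⟩ j ⟨hj, hDj⟩ hij
    by_contra hne
    have hdist := hsep i j (by rwa [hΩ.mem_iff_label_eq.1 hi, hΩ.mem_iff_label_eq.1 hj])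
    rw [hΩ.mem_iff_label_eq.1 hi, hΩ.mem_iff_label_eq.1 hj] at hdist
    have htri : dist (x i) (x j) ^ 2 ≤
        2 * (dist (x i) (y (hhat.label i)) ^ 2 + dist (x j) (y (hhat.label j)) ^ 2) :=
      hij ▸ dist_sq_le_two_mul_add (x i) (x j) (y (hhat.label i))
    linarith [hΩ.inv_maxClusterCard_le_inv_card k, hΩ.inv_maxClusterCard_le_inv_card l]
  obtain ⟨h, hh⟩ := exists_perm_of_separated hgood hlabel
  have hbad (k : Fin r) : Ω k \ Ωhat (h k) ⊆ {i ∈ Ω k | w k ≤ D i} := by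
    intro i hi
    rw [mem_sdiff, hhat.mem_iff_label_eq] at hi
    exact mem_filter.2 ⟨hi.1, not_lt.1 fun hlt => hi.2 (hh k i ⟨hi.1, hlt⟩)⟩
  refine (misclusteringRate_le_of_subset h hbad).trans (le_trans ?_ hmarkov)
  gcongr
  exact le_add_of_nonneg_right (by positivity)

end Misclustering

section Features

open scoped Matrix.Norms.Frobenius

theorem sum_sum_sum_sq_le_sq {ι α R : Type*} [Fintype ι] [CommRing R] [LinearOrder R]
    [IsStrictOrderedRing R] {Ω : ι → Finset α} {f : α → α → R} {b : R} (hf : ∀ i j, 0 ≤ f i j)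
    (hb : ∑ k, ∑ i ∈ Ω k, ∑ j ∈ Ω k, f i j ≤ b) :
    ∑ k, ∑ i ∈ Ω k, ∑ j ∈ Ω k, f i j ^ 2 ≤ b ^ 2 := by
  simp only [← sum_product'] at hb ⊢
  rw [sum_sigma'] at hb ⊢
  exact (sum_sq_le_sq_sum_of_nonneg fun _ _ => hf _ _).trans
    (pow_le_pow_left₀ (sum_nonneg fun _ _ => hf _ _) hb 2)

variable {n p s r : ℕ}

theorem sum_sq_featureMatrix_sub_le (S : MJS n p s) (αA αB αT : ℝ) (i i' : Fin s) :
    ∑ j, (featureMatrix S αA αB αT i j - featureMatrix S αA αB αT i' j) ^ 2 ≤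
      αA ^ 2 * ‖S.A i - S.A i'‖ ^ 2 + αB ^ 2 * ‖S.B i - S.B i'‖ ^ 2 +
        αT ^ 2 * (∑ j, |S.T i j - S.T i' j|) ^ 2 := by
  have hT : ∑ j, (S.T i j - S.T i' j) ^ 2 ≤ (∑ j, |S.T i j - S.T i' j|) ^ 2 := by
    simpa only [sq_abs] using sum_sq_le_sq_sum_of_nonneg (s := univ)
      (f := fun j => |S.T i j - S.T i' j|) fun _ _ => abs_nonneg _
  calc ∑ j, (featureMatrix S αA αB αT i j - featureMatrix S αA αB αT i' j) ^ 2
      = αA ^ 2 * ‖S.A i - S.A i'‖ ^ 2 + αB ^ 2 * ‖S.B i - S.B i'‖ ^ 2 +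
          αT ^ 2 * ∑ j, (S.T i j - S.T i' j) ^ 2 := by
        rw [← Matrix.frobenius_norm_transpose (S.A i - S.A i'),
          ← Matrix.frobenius_norm_transpose (S.B i - S.B i')]
        simp [frobenius_norm_sq_eq_sum, featureMatrix, Fintype.sum_sum_type,
          Fintype.sum_prod_type, Matrix.vec, ← mul_sub, mul_pow, ← mul_sum, add_assoc]
    _ ≤ _ := by gcongr

theorem IsAggregatableCase.frobenius_norm_sub_averagedMatrix_le {S : MJS n p s}
    {Ω : Fin r → Finset (Fin s)} {εA εB εT : ℝ} (hS : IsAggregatableCase S Ω εA εB εT)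
    (αA αB αT : ℝ) :
    ‖featureMatrix S αA αB αT - averagedMatrix Ω (featureMatrix S αA αB αT)‖ ≤
      epsAgg αA αB αT εA εB εT := by
  refine Real.le_sqrt_of_sq_le ((hS.isPartition.frobenius_norm_sub_averagedMatrix_sq_le _).trans
    ((sum_le_sum fun k _ => sum_le_sum fun i _ => sum_le_sum fun i' _ =>
      sum_sq_featureMatrix_sub_le S αA αB αT i i').trans ?_))
  simp only [sum_add_distrib, ← mul_sum]
  gcongr
  · exact sum_sum_sum_sq_le_sq (fun _ _ => norm_nonneg _) hS.bound_A
  · exact sum_sum_sum_sq_le_sq (fun _ _ => norm_nonneg _) hS.bound_B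
  · exact sum_sum_sum_sq_le_sq (fun _ _ => sum_nonneg fun _ _ => abs_nonneg _) hS.bound_T

end Features

section SpectralClustering

variable {s r : ℕ} {Ω Ωhat : Fin r → Finset (Fin s)}

theorem IsPartition.misclusteringRate_le_kmeansCost (hΩ : IsPartition Ω) (hhat : IsPartition Ωhat)
    {y : Fin r → EuclideanSpace ℝ (Fin s)}
    (h : 4 * kmeansCost (clusterProjection Ω) Ωhat y <
      ((minClusterCard Ω : ℝ) + maxClusterCard Ω) / maxClusterCard Ω) :
    misclusteringRate Ω Ωhat ≤ 4 * kmeansCost (clusterProjection Ω) Ωhat y := by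
  rw [hhat.kmeansCost_eq_sum] at h ⊢
  exact hΩ.misclusteringRate_le_of_separated hhat
    (fun i j hij => (hΩ.dist_clusterProjection_sq hij).ge) h

open scoped Matrix.Norms.Frobenius in
theorem IsApproxKMeans.exists_kmeansCost_clusterProjection_le {κ : Type*} [Fintype κ]
    [DecidableEq κ] {Φ : Matrix (Fin s) κ ℝ} {U : Matrix (Fin s) (Fin r) ℝ} {ε η : ℝ}
    {c : Fin r → EuclideanSpace ℝ (Fin r)} (hc : IsApproxKMeans ε U Ωhat c) (hε : 0 ≤ ε)
    (hU : IsTopLeftSingularVectors Φ U) (hΩ : IsPartition Ω)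
    (hη : ‖Φ - averagedMatrix Ω Φ‖ ≤ η) (hrank : (averagedMatrix Ω Φ).rank = r) (hr : 0 < r) :
    ∃ y, kmeansCost (clusterProjection Ω) Ωhat y ≤
      12 * (2 + ε) * (singularValue (averagedMatrix Ω Φ) r ^ 2)⁻¹ * η ^ 2 := by
  have hσ : 0 < singularValue (averagedMatrix Ω Φ) r := singularValue_pos hrank hr
  have hsin := hU.singularValue_mul_norm_le hΩ.isStarProjection_clusterProjection
    hΩ.trace_clusterProjection (by rw [clusterProjection_mul, hrank])
  rw [clusterProjection_mul, ← le_div_iff₀' hσ] at hsin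
  refine ⟨_, (hc.kmeansCost_clusterProjection_le hε hU.conjTranspose_mul_self hΩ).trans ?_⟩
  calc 3 * (2 + ε) * ‖(1 - U * Uᴴ) * clusterProjection Ω‖ ^ 2
      ≤ 3 * (2 + ε) * (2 * η / singularValue (averagedMatrix Ω Φ) r) ^ 2 := by
        gcongr
        exact hsin.trans (by gcongr)
    _ = _ := by ring

open scoped Matrix.Norms.Frobenius in
theorem IsApproxKMeans.misclusteringRate_le {κ : Type*} [Fintype κ] [DecidableEq κ]
    {Φ : Matrix (Fin s) κ ℝ} {U : Matrix (Fin s) (Fin r) ℝ} {ε η : ℝ}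
    {c : Fin r → EuclideanSpace ℝ (Fin r)} (hc : IsApproxKMeans ε U Ωhat c) (hε : 0 ≤ ε)
    (hU : IsTopLeftSingularVectors Φ U) (hΩ : IsPartition Ω)
    (hη : ‖Φ - averagedMatrix Ω Φ‖ ≤ η) (hrank : (averagedMatrix Ω Φ).rank = r) (hr : 0 < r)
    (h : 48 * (2 + ε) * (singularValue (averagedMatrix Ω Φ) r ^ 2)⁻¹ * η ^ 2 <
      ((minClusterCard Ω : ℝ) + maxClusterCard Ω) / maxClusterCard Ω) :
    misclusteringRate Ω Ωhat ≤
      48 * (2 + ε) * (singularValue (averagedMatrix Ω Φ) r ^ 2)⁻¹ * η ^ 2 := by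
  obtain ⟨y, hy⟩ := hc.exists_kmeansCost_clusterProjection_le hε hU hΩ hη hrank hr
  have hcost : 4 * kmeansCost (clusterProjection Ω) Ωhat y ≤
      48 * (2 + ε) * (singularValue (averagedMatrix Ω Φ) r ^ 2)⁻¹ * η ^ 2 := by linarith
  exact (hΩ.misclusteringRate_le_kmeansCost hc.1 (hcost.trans_lt h)).trans hcost

theorem mul_inv_sq_mul_sq_le_div {η σ a b N : ℝ} (hη : 0 ≤ η) (hσ : 0 < σ) (ha : 0 < a)
    (hb : 0 ≤ b) (hN : 0 < N) (h : η ≤ σ * √b / (8 * √(a * N))) :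
    64 * a * (σ ^ 2)⁻¹ * η ^ 2 ≤ b / N := by
  calc 64 * a * (σ ^ 2)⁻¹ * η ^ 2 ≤ 64 * a * (σ ^ 2)⁻¹ * (σ * √b / (8 * √(a * N))) ^ 2 := by
        gcongr
    _ = b / N := by
        rw [div_pow, mul_pow, mul_pow, Real.sq_sqrt hb, Real.sq_sqrt (by positivity)]
        field_simp
        ring

end SpectralClustering

end MJSReduction

open scoped Matrix.Norms.Frobenius in
theorem theorem1_general {s r : ℕ} {κ : Type*} [Fintype κ] [DecidableEq κ]
    {Φ : Matrix (Fin s) κ ℝ} {Ω Ωhat : Fin r → Finset (Fin s)} (hΩ : IsPartition Ω) {η : ℝ}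
    (hη : ‖Φ - averagedMatrix Ω Φ‖ ≤ η) {ε : ℝ} (hε : 0 ≤ ε) {U : Matrix (Fin s) (Fin r) ℝ}
    (hU : IsTopLeftSingularVectors Φ U) {c : Fin r → EuclideanSpace ℝ (Fin r)}
    (hc : IsApproxKMeans ε U Ωhat c) (hrank : (averagedMatrix Ω Φ).rank = r) :
    (η ≤ singularValue (averagedMatrix Ω Φ) r *
          √((minClusterCard Ω : ℝ) + (maxClusterCard Ω : ℝ)) /
          (8 * √((2 + ε) * (maxClusterCard Ω : ℝ))) →
      misclusteringRate Ω Ωhat ≤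
        64 * (2 + ε) * ((singularValue (averagedMatrix Ω Φ) r) ^ 2)⁻¹ * η ^ 2) ∧
    (η ≤ singularValue (averagedMatrix Ω Φ) r / (8 * √((2 + ε) * (maxClusterCard Ω : ℝ))) →
      misclusteringRate Ω Ωhat = 0) := by
  rcases Nat.eq_zero_or_pos r with rfl | hr
  · have hMR : misclusteringRate Ω Ωhat = 0 := by simp [misclusteringRate]
    exact ⟨fun _ => hMR ▸ by positivity, fun _ => hMR⟩
  have hη0 : 0 ≤ η := (norm_nonneg _).trans hη
  have hN : (0 : ℝ) < maxClusterCard Ω := hΩ.cast_maxClusterCard_pos ⟨0, hr⟩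
  have hσ := singularValue_pos hrank hr
  have hnonneg : 0 ≤ (2 + ε) * (singularValue (averagedMatrix Ω Φ) r ^ 2)⁻¹ * η ^ 2 := by positivity
  have h64 {b : ℝ} (hb : 0 ≤ b) :=
    mul_inv_sq_mul_sq_le_div hη0 hσ (by linarith : 0 < 2 + ε) hb hN
  have hMR := hc.misclusteringRate_le hε hU hΩ hη hrank hr
  refine ⟨fun h => ?_, fun h => hΩ.misclusteringRate_eq_zero_of_lt ?_⟩
  · have hpos : 0 < ((minClusterCard Ω : ℝ) + maxClusterCard Ω) / maxClusterCard Ω := by positivity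
    linarith [h64 (by positivity) h, hMR (by linarith [h64 (by positivity) h])]
  · have hsmall := h64 zero_le_one (by simpa only [Real.sqrt_one, mul_one] using h)
    have hle : 1 / (maxClusterCard Ω : ℝ) ≤
        ((minClusterCard Ω : ℝ) + maxClusterCard Ω) / maxClusterCard Ω := by
      gcongr
      exact le_add_of_nonneg_of_le (Nat.cast_nonneg _) (Nat.one_le_cast.2 (Nat.cast_pos.1 hN))
    have hpos : 0 < 1 / (maxClusterCard Ω : ℝ) := by positivity
    rw [inv_eq_one_div]
    linarith [hMR (by linarith)]

theorem theorem1 {n p s r : ℕ} (S : MJS n p s)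
    (Ω : Fin r → Finset (Fin s)) (εA εB εT : ℝ)
    (hS : IsAggregatableCase S Ω εA εB εT)
    (αA αB αT : ℝ) (hαA : 0 ≤ αA) (hαB : 0 ≤ αB) (hαT : 0 ≤ αT) (hα : αA + αB + αT = 1)
    (ε : ℝ) (hε : 0 ≤ ε)
    (U : Matrix (Fin s) (Fin r) ℝ) (Ωhat : Fin r → Finset (Fin s))
    (c : Fin r → EuclideanSpace ℝ (Fin r))
    (hAlg : IsAlgorithmOutput S αA αB αT ε U Ωhat c)
    (hrank : (averagedMatrix Ω (featureMatrix S αA αB αT)).rank = r) :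
    (epsAgg αA αB αT εA εB εT ≤
        singularValue (averagedMatrix Ω (featureMatrix S αA αB αT)) r *
          √((minClusterCard Ω : ℝ) + (maxClusterCard Ω : ℝ)) /
          (8 * √((2 + ε) * (maxClusterCard Ω : ℝ))) →
      misclusteringRate Ω Ωhat ≤
        64 * (2 + ε) *
          ((singularValue (averagedMatrix Ω (featureMatrix S αA αB αT)) r) ^ 2)⁻¹ *
          epsAgg αA αB αT εA εB εT ^ 2) ∧
    (epsAgg αA αB αT εA εB εT ≤
        singularValue (averagedMatrix Ω (featureMatrix S αA αB αT)) r /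
          (8 * √((2 + ε) * (maxClusterCard Ω : ℝ))) →
      misclusteringRate Ω Ωhat = 0) :=
  theorem1_general hS.isPartition (hS.frobenius_norm_sub_averagedMatrix_le αA αB αT) hε
    hAlg.singularVectors hAlg.kmeans hrank
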